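/- \textbf{Setting.} Fix a first-order signature (function and relation symbols) and countably many variables. A (definite) query is a finite sequence of atoms, a definite clause has the form $H\leftarrow B_1,\dots,B_m$ with $H, B_1,\dots,B_m$ atoms, and a definite program is a set of definite clauses; $\mathit{rel}(A)$ is the relation symbol of the atom $A$, and $\mathit{ground}(P)$ is the set of all ground instances of clauses of $P$. A relation is \emph{defined in} $P$ if it occurs in the head of a clause of $P$; $P$ \emph{extends} $R$ if no relation defined in $P$ occurs in $R$. The Herbrand base $B_R$ is the set of ground atoms whose relation occurs in $R$. Models are Herbrand models. A level mapping is a function from ground atoms to $\mathbb N$. In $P$, $p$ \emph{depends on} $q$ if $(p,q)$ is in the reflexive transitive closure of the relation "some clause of $P$ has $p$ in its head and $q$ in its body"; $p\simeq q$ means that $p$ and $q$ depend on each other, and $p\sqsupset q$ that $p$ depends on $q$ but $q$ does not depend on $p$. Let $M$ be a model of $P$. $P$ is \emph{semi-acceptable} wrt. $|\cdot|$ and $M$ if for every clause $A\leftarrow\mathbf A,B,\mathbf B$ in $\mathit{ground}(P)$ with $M\models\mathbf A$: $|A|>|B|$ if $\mathit{rel}(A)\simeq\mathit{rel}(B)$,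 and $|A|\ge|B|$ if $\mathit{rel}(A)\sqsupset\mathit{rel}(B)$. $P$ is \emph{acceptable} wrt. $|\cdot|$ and $M$ if $|A|>|B|$ for all such clauses and all such $B$. An atom $A$ is \emph{bounded} wrt. $|\cdot|$ if the set of levels of its ground instances is finite. A query $Q=A_1,\dots,A_n$ is \emph{bounded} wrt. $|\cdot|$ and $M$ if for each $i\in\{1,\dots,n\}$ the set $\{|A_i'| : A'_1,\dots,A'_n \text{ is a ground instance of } Q \text{ and } M\models A_1',\dots,A_{i-1}'\}$ is finite. $\mathit{Call}_P(Q)$ is the set of first atoms of the non-empty queries that occur in LD-derivations of $P\cup\{Q\}$ (SLD-derivations with the leftmost selection rule). If $P$ extends $R$, a query $Q$ is \emph{strongly bounded} wrt. $P\cup R$ and $|\cdot|_P,|\cdot|_R$ if every $A\in \mathit{Call}_{P\cup R}(Q)$ whose relation is defined in $P$ (resp. in $R$) is bounded wrt. $|\cdot|_P$ (resp. $|\cdot|_R$). When $P$ extends $R$, $P\sqsupset R$ is a \emph{finest decomposition} of $P\cup R$ if no two relations $p,q$ that are both defined in $P$, or both defined in $R$, satisfy $p\sqsupset q$ in $P\cup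 R$. \textbf{Theorem.} Let $P$ and $R$ be definite programs such that $P$ extends $R$, let $M$ be a model of $P\cup R$, and let $|\cdot|_P$, $|\cdot|_R$ and $\|\cdot\|_P$ be level mappings. Suppose that (a) $R$ is semi-acceptable wrt. $|\cdot|_R$ and $M\cap B_R$; (b) $P$ is semi-acceptable wrt. $|\cdot|_P$ and $M$; (c) for every clause $A\leftarrow\mathbf A,B,\mathbf B$ in $\mathit{ground}(P)$ with $M\models\mathbf A$: $\|A\|_P\ge\|B\|_P$ if $\mathit{rel}(B)$ is defined in $P$, and $\|A\|_P\ge|B|_R$ if $\mathit{rel}(B)$ is defined in $R$; (d) $P\sqsupset R$ is a finest decomposition of $P\cup R$. Let $|\cdot|$ be a level mapping with $|A|=|A|_P+\|A\|_P$ if $\mathit{rel}(A)$ is defined in $P$ and $|A|=|A|_R$ if $\mathit{rel}(A)$ is defined in $R$ (with arbitrary values on other atoms). Then every query that is bounded wrt. $|\cdot|$ and $M$ is strongly bounded wrt. $P\cup R$ and $|\cdot|_P,|\cdot|_R$. Consequently the criterion "each module is acceptable and the query is strongly bounded" applies to all these queries, with level mappings that do not involve $\|\cdot\|_P$: put $|A|'_P=|A|_P+1$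 if $\mathit{rel}(A)$ is defined in $P$ and $|A|'_P=0$ otherwise, and define $|\cdot|'_R$ from $|\cdot|_R$ and $R$ in the same way. Then $R$ is acceptable wrt. $|\cdot|'_R$ and $M$, $P$ is acceptable wrt. $|\cdot|'_P$ and $M$, and every query that is bounded wrt. $|\cdot|$ and $M$ is strongly bounded wrt. $P\cup R$ and $|\cdot|'_P,|\cdot|'_R$. -/

import Mathlib

universe u v

namespace LP

/-- An atom `p(t₁, …, tₙ)` over the first-order signature `L`, with variables from `α`. -/
structure Atom (L : FirstOrder.Language.{u, v}) (α : Type) where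
  arity : ℕ
  sym : L.Relations arity
  args : Fin arity → L.Term α

/-- Relation (predicate) symbols, each with its arity. -/
abbrev Pred (L : FirstOrder.Language.{u, v}) : Type v := Σ n, L.Relations n

/-- A substitution of terms with variables from `β` for the variables in `α`. -/
abbrev Subst (L : FirstOrder.Language.{u, v}) (α β : Type) : Type u := α → L.Term β

/-- Definite queries: finite sequences of atoms. -/
abbrev Query (L : FirstOrder.Language.{u, v}) (α : Type) := List (Atom L α)

/-- Definite clauses `head ← body`. -/
structure Clause (L : FirstOrder.Language.{u, v}) (α : Type) where
  head : Atom L α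
  body : Query L α

/-- Definite programs. The variables of a program are the natural numbers. -/
abbrev Program (L : FirstOrder.Language.{u, v}) := Set (Clause L ℕ)

/-- Ground atoms: atoms without variables. -/
abbrev GroundAtom (L : FirstOrder.Language.{u, v}) := Atom L Empty

/-- Level mappings assign natural numbers to ground atoms. -/
abbrev LevelMapping (L : FirstOrder.Language.{u, v}) := GroundAtom L → ℕ

section Basics

variable {L : FirstOrder.Language.{u, v}} {α β : Type}

/-- The relation symbol of an atom. -/
def Atom.rel (A : Atom L α) : Pred L := ⟨A.arity, A.sym⟩

/-- Application of a substitution to an atom. -/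
def Atom.subst (A : Atom L α) (σ : Subst L α β) : Atom L β :=
  ⟨A.arity, A.sym, fun i => (A.args i).subst σ⟩

/-- Application of a substitution to a query. -/
def substQuery (Q : Query L α) (σ : Subst L α β) : Query L β :=
  Q.map fun A => A.subst σ

/-- Application of a substitution to a clause. -/
def Clause.subst (c : Clause L α) (σ : Subst L α β) : Clause L β :=
  ⟨c.head.subst σ, substQuery c.body σ⟩

/-- The inclusion of variable-free terms into the terms with variables, as a substitution. -/
def incl (L : FirstOrder.Language.{u, v}) : Subst L Empty ℕ := fun e => e.elim

/-- The ground atom `G` is a ground instance of the atom `A`. -/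
def IsGroundInstAtom (G : GroundAtom L) (A : Atom L ℕ) : Prop :=
  ∃ σ : Subst L ℕ ℕ, A.subst σ = G.subst (incl L)

/-- The ground query `G` is a ground instance of the query `Q`. -/
def IsGroundInstQuery (G : Query L Empty) (Q : Query L ℕ) : Prop :=
  ∃ σ : Subst L ℕ ℕ, substQuery Q σ = substQuery G (incl L)

/-- `ground(P)`: the ground instances of the clauses of `P`. -/
def ground (P : Program L) : Set (Clause L Empty) :=
  {g | ∃ c ∈ P, ∃ σ : Subst L ℕ ℕ, c.subst σ = g.subst (incl L)}

/-- The relation `p` is defined in `P`: it occurs in the head of a clause of `P`. -/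
def DefinedIn (p : Pred L) (P : Program L) : Prop := ∃ c ∈ P, c.head.rel = p

/-- The relation `p` occurs in `P`. -/
def OccursIn (p : Pred L) (P : Program L) : Prop :=
  ∃ c ∈ P, c.head.rel = p ∨ ∃ B ∈ c.body, B.rel = p

/-- The Herbrand base of `P`: the ground atoms whose relation occurs in `P`
(the function symbols are those of the common signature). -/
def herbrandBase (P : Program L) : Set (GroundAtom L) := {A | OccursIn A.rel P}

/-- The Herbrand interpretation `M` is a model of `P`. -/
def IsModel (M : Set (GroundAtom L)) (P : Program L) : Prop :=
  ∀ c ∈ ground P, (∀ B ∈ c.body, B ∈ M) → c.head ∈ M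

/-- `p` refers to `q` in `P`. -/
def RefersTo (P : Program L) (p q : Pred L) : Prop :=
  ∃ c ∈ P, c.head.rel = p ∧ ∃ B ∈ c.body, B.rel = q

/-- `p` depends on `q` in `P`. -/
def DependsOn (P : Program L) (p q : Pred L) : Prop :=
  Relation.ReflTransGen (RefersTo P) p q

/-- `p ≃ q`: mutual recursion in `P`. -/
def MutRec (P : Program L) (p q : Pred L) : Prop := DependsOn P p q ∧ DependsOn P q p

/-- `p ⊐ q` in `P`: `p` depends on `q` but `q` does not depend on `p`. -/
def StrictlyAbove (P : Program L) (p q : Pred L) : Prop :=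
  DependsOn P p q ∧ ¬ DependsOn P q p

/-- `P` extends `R`: no relation defined in `P` occurs in `R`. -/
def Extends (P R : Program L) : Prop := ∀ p, DefinedIn p P → ¬ OccursIn p R

/-- `R (n-1) ⊐ … ⊐ R 0` is a hierarchy of programs: every module extends the union of
the modules below it. -/
def IsHierarchy {n : ℕ} (R : Fin n → Program L) : Prop :=
  ∀ i, Extends (R i) (⋃ j, ⋃ _ : j < i, R j)

/-- `R (n-1) ⊐ … ⊐ R 0` is a finest decomposition of `P`. -/
def IsFinestDecomposition {n : ℕ} (R : Fin n → Program L) (P : Program L) : Prop :=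
  1 ≤ n ∧ (⋃ i, R i) = P ∧ IsHierarchy R ∧
    ∀ i p q, DefinedIn p (R i) → DefinedIn q (R i) →
      ¬ StrictlyAbove P p q ∧ ¬ StrictlyAbove P q p

/-- `P` is semi-acceptable with respect to the level mapping `lev` and the model `M`. -/
def SemiAcceptable (P : Program L) (lev : LevelMapping L) (M : Set (GroundAtom L)) : Prop :=
  IsModel M P ∧
    ∀ c ∈ ground P, ∀ (As : Query L Empty) (B : GroundAtom L) (Bs : Query L Empty),
      c.body = As ++ B :: Bs → (∀ A ∈ As, A ∈ M) →
        (MutRec P c.head.rel B.rel → lev B < lev c.head) ∧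
        (StrictlyAbove P c.head.rel B.rel → lev B ≤ lev c.head)

/-- `P` is acceptable with respect to the level mapping `lev` and the model `M`.
(For a definite program every model is a complete model.) -/
def Acceptable (P : Program L) (lev : LevelMapping L) (M : Set (GroundAtom L)) : Prop :=
  IsModel M P ∧
    ∀ c ∈ ground P, ∀ (As : Query L Empty) (B : GroundAtom L) (Bs : Query L Empty),
      c.body = As ++ B :: Bs → (∀ A ∈ As, A ∈ M) → lev B < lev c.head

/-- The atom `A` is bounded with respect to `lev`. -/
def BoundedAtom (lev : LevelMapping L) (A : Atom L ℕ) : Prop :=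
  {k | ∃ G, IsGroundInstAtom G A ∧ lev G = k}.Finite

/-- The set of levels of the `i`-th atoms (counted from `0`) of those ground instances of `Q`
whose earlier atoms are true in `M`. -/
def levelSet (lev : LevelMapping L) (M : Set (GroundAtom L)) (Q : Query L ℕ) (i : ℕ) : Set ℕ :=
  {k | ∃ G : Query L Empty, IsGroundInstQuery G Q ∧ (∀ A ∈ G.take i, A ∈ M) ∧
    ∃ B, G[i]? = some B ∧ lev B = k}

/-- The query `Q` is bounded with respect to `lev` and `M`. -/
def BoundedQuery (lev : LevelMapping L) (M : Set (GroundAtom L)) (Q : Query L ℕ) : Prop :=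
  ∀ i < Q.length, (levelSet lev M Q i).Finite

end Basics

section Resolution

variable {L : FirstOrder.Language.{u, v}}

/-- The variables of a term. -/
def termVars (t : L.Term ℕ) : Set ℕ := {x | x ∈ t.varFinset}

/-- The variables of an atom. -/
def Atom.vars (A : Atom L ℕ) : Set ℕ := ⋃ i, termVars (A.args i)

/-- The variables of a query. -/
def queryVars (Q : Query L ℕ) : Set ℕ := {x | ∃ A ∈ Q, x ∈ A.vars}

/-- The variables of a clause. -/
def Clause.vars (c : Clause L ℕ) : Set ℕ := c.head.vars ∪ queryVars c.body

/-- The domain of a substitution. -/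
def substDom (θ : Subst L ℕ ℕ) : Set ℕ := {x | θ x ≠ FirstOrder.Language.Term.var x}

/-- The variables of a substitution: its domain and the variables of its range. -/
def substVars (θ : Subst L ℕ ℕ) : Set ℕ :=
  substDom θ ∪ ⋃ x ∈ substDom θ, termVars (θ x)

/-- `c'` is a variant of `c`: it arises from `c` by a permutation of the variables. -/
def IsVariant (c' c : Clause L ℕ) : Prop :=
  ∃ ρ : Equiv.Perm ℕ, c' = c.subst fun x => FirstOrder.Language.Term.var (ρ x)

/-- The (finite) substitution `θ` is a most general unifier of the atoms `A` and `B`. -/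
def IsMGU (θ : Subst L ℕ ℕ) (A B : Atom L ℕ) : Prop :=
  (substDom θ).Finite ∧ A.subst θ = B.subst θ ∧
    ∀ η : Subst L ℕ ℕ, A.subst η = B.subst η → ∃ γ : Subst L ℕ ℕ, ∀ x, η x = (θ x).subst γ

/-- `LDReach P Q V Q'`: some LD-derivation of `P ∪ {Q}` (leftmost selection rule) arrives at the
query `Q'`, where `V` is the set of variables used so far: those of `Q` and of the input clauses
and most general unifiers of the earlier steps. Input clauses are standardized apart from `V`. -/
inductive LDReach (P : Program L) (Q : Query L ℕ) : Set ℕ → Query L ℕ → Prop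
  | start : LDReach P Q (queryVars Q) Q
  | step {V : Set ℕ} {A : Atom L ℕ} {Bs : Query L ℕ} {c c' : Clause L ℕ} {θ : Subst L ℕ ℕ} :
      LDReach P Q V (A :: Bs) → c ∈ P → IsVariant c' c → Disjoint c'.vars V →
      IsMGU θ A c'.head →
      LDReach P Q (V ∪ c'.vars ∪ substVars θ) (substQuery (c'.body ++ Bs) θ)

/-- `Q'` is an LD-descendant of `P ∪ {Q}`. -/
def IsDescendant (P : Program L) (Q Q' : Query L ℕ) : Prop := ∃ V, LDReach P Q V Q'

/-- `Call_P(Q)`: the first atoms of the non-empty LD-descendants of `P ∪ {Q}`. -/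
def Call (P : Program L) (Q : Query L ℕ) : Set (Atom L ℕ) :=
  {A | ∃ Bs, IsDescendant P Q (A :: Bs)}

/-- The query `Q` is strongly bounded with respect to the program `⋃ i, R i`, given as the
hierarchy `R (n-1) ⊐ … ⊐ R 0`, and the level mappings `lev i` for the modules `R i`. -/
def StronglyBounded {n : ℕ} (R : Fin n → Program L) (lev : Fin n → LevelMapping L)
    (Q : Query L ℕ) : Prop :=
  ∀ A ∈ Call (⋃ i, R i) Q, ∀ i, DefinedIn A.rel (R i) → BoundedAtom (lev i) A

open Classical in
/-- The level mapping of a module `P` that is derived from `lev`: shifted by one on the atoms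
defined in `P`, and `0` on all other atoms. -/
noncomputable def moduleLevel (P : Program L) (lev : LevelMapping L) : LevelMapping L :=
  fun A => if DefinedIn A.rel P then lev A + 1 else 0

end Resolution

end LP

namespace LP

/-! Strict decrease is not needed for boundedness of calls: it is enough that a level never
increases from a ground head to a body atom preceded by true atoms. The combined level has this
property on `P ∪ R`. Inside `P`, both `levP` and `linkP` weakly decrease; from `P` to `R`, `linkP`
of the head already dominates `levR`; inside `R`, semi-acceptability applies. Atoms defined in
neither module are given level 0 (`definedLevel`), since `lev` is arbitrary there.

By `BoundedQuery.resolvent`, boundedness then passes along LD-derivations, so every called atom is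
bounded for the combined level, hence for the smaller level of its own module.

For acceptability, a finest decomposition makes dependent relations of one module mutually
recursive, first in `P ∪ R` and then, since `P` extends `R`, in the module itself.
Semi-acceptability is therefore strict inside a module, and the shift by one handles body atoms
defined elsewhere. -/

variable {L : FirstOrder.Language.{u, v}} {α β γ : Type}

/-! ### Substitutions and ground instances -/

theorem Atom.subst_subst (A : Atom L α) (σ : Subst L α β) (τ : Subst L β γ) :
    (A.subst σ).subst τ = A.subst fun x => (σ x).subst τ := by
  simp only [Atom.subst, Atom.mk.injEq, heq_eq_eq, true_and]
  funext i
  induction A.args i with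
  | var x => rfl
  | func f ts ih => simp [FirstOrder.Language.Term.subst, ih]

theorem substQuery_substQuery (Q : Query L α) (σ : Subst L α β) (τ : Subst L β γ) :
    substQuery (substQuery Q σ) τ = substQuery Q fun x => (σ x).subst τ := by
  simp [substQuery, Atom.subst_subst]

theorem Clause.subst_subst (c : Clause L α) (σ : Subst L α β) (τ : Subst L β γ) :
    (c.subst σ).subst τ = c.subst fun x => (σ x).subst τ := by
  simp [Clause.subst, Atom.subst_subst, substQuery_substQuery]

theorem Atom.subst_ground (G : GroundAtom L) (σ : Subst L Empty Empty) : G.subst σ = G := by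
  obtain ⟨n, s, a⟩ := G
  simp only [Atom.subst, Atom.mk.injEq, heq_eq_eq, true_and]
  funext i
  induction a i with
  | var x => exact x.elim
  | func f ts ih => simp [FirstOrder.Language.Term.subst, ih]

theorem substQuery_ground (G : Query L Empty) (σ : Subst L Empty Empty) :
    substQuery G σ = G := by
  simp [substQuery, Atom.subst_ground]

@[simp] theorem Atom.rel_subst (A : Atom L α) (σ : Subst L α β) : (A.subst σ).rel = A.rel := rfl

theorem IsGroundInstAtom.rel_eq {G : GroundAtom L} {A : Atom L ℕ} (h : IsGroundInstAtom G A) :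
    G.rel = A.rel := by
  obtain ⟨σ, hσ⟩ := h
  simpa using (congrArg Atom.rel hσ).symm

/-- A substitution by closed terms turns a clause of `P` into an element of `ground P`. -/
theorem subst_mem_ground {P : Program L} {c : Clause L ℕ} (hc : c ∈ P) (δ : Subst L ℕ Empty) :
    c.subst δ ∈ ground P :=
  ⟨c, hc, fun x => (δ x).subst (incl L), (Clause.subst_subst c δ (incl L)).symm⟩

/-- Variables left by the instantiating substitution are filled with a fixed closed term. Without
closed terms no `δ` exists, although a propositional query still has a ground instance. -/
theorem isGroundInstQuery_iff [Nonempty (L.Term Empty)] {G : Query L Empty} {Q : Query L ℕ} :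
    IsGroundInstQuery G Q ↔ ∃ δ : Subst L ℕ Empty, substQuery Q δ = G := by
  constructor
  · rintro ⟨σ, hσ⟩
    obtain ⟨t⟩ := ‹Nonempty (L.Term Empty)›
    refine ⟨fun x => (σ x).subst fun _ => t, ?_⟩
    rw [← substQuery_substQuery, hσ, substQuery_substQuery, substQuery_ground]
  · rintro ⟨δ, rfl⟩
    exact ⟨fun x => (δ x).subst (incl L), (substQuery_substQuery Q δ (incl L)).symm⟩

theorem isGroundInstAtom_iff [Nonempty (L.Term Empty)] {G : GroundAtom L} {A : Atom L ℕ} :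
    IsGroundInstAtom G A ↔ ∃ δ : Subst L ℕ Empty, A.subst δ = G := by
  have h := isGroundInstQuery_iff (L := L) (G := [G]) (Q := [A])
  simpa [IsGroundInstQuery, substQuery, IsGroundInstAtom] using h

/-- Over a signature without closed terms, an atom has at most one ground instance. -/
theorem boundedAtom_of_isEmpty [IsEmpty (L.Term Empty)] (lev : LevelMapping L) (A : Atom L ℕ) :
    BoundedAtom lev A := by
  refine Set.Subsingleton.finite ?_
  rintro _ ⟨G, hG, rfl⟩ _ ⟨G', hG', rfl⟩
  have h : G.rel = G'.rel := hG.rel_eq.trans hG'.rel_eq.symm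
  obtain ⟨n, s, a⟩ := G
  obtain ⟨n', s', a'⟩ := G'
  simp only [Atom.rel, Sigma.mk.injEq] at h
  obtain ⟨rfl, h⟩ := h
  obtain rfl := eq_of_heq h
  congr 2
  funext i
  exact isEmptyElim (a i)

/-! ### Boundedness along LD-derivations -/

/-- The level does not increase from the head of a ground clause to those body atoms that are
preceded by true atoms only. -/
def WeaklyDecreasing (P : Program L) (lev : LevelMapping L) (M : Set (GroundAtom L)) : Prop :=
  ∀ c ∈ ground P, ∀ (As : Query L Empty) (B : GroundAtom L) (Bs : Query L Empty),
    c.body = As ++ B :: Bs → (∀ A ∈ As, A ∈ M) → lev B ≤ lev c.head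

/-- LD-resolvents of bounded queries are bounded. -/
theorem BoundedQuery.resolvent [Nonempty (L.Term Empty)] {P : Program L} {lev : LevelMapping L}
    {M : Set (GroundAtom L)} (hM : IsModel M P) (hlev : WeaklyDecreasing P lev M)
    {A : Atom L ℕ} {Bs : Query L ℕ} (hQ : BoundedQuery lev M (A :: Bs)) {c c' : Clause L ℕ}
    (hc : c ∈ P) (hv : IsVariant c' c) {θ : Subst L ℕ ℕ} (hθ : A.subst θ = c'.head.subst θ) :
    BoundedQuery lev M (substQuery (c'.body ++ Bs) θ) := by
  -- A ground instance of the resolvent by `δ` comes from applying `θ` followed by `δ` to both the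
  -- old query and the input clause; as `θ` unifies, the instance of `A` is the head of the ground
  -- clause `g`.
  have key : ∀ δ : Subst L ℕ Empty, ∃ ε : Subst L ℕ Empty, ∃ g ∈ ground P,
      A.subst ε = g.head ∧
      substQuery (substQuery (c'.body ++ Bs) θ) δ = g.body ++ substQuery Bs ε ∧
      g.body.length = c'.body.length := by
    intro δ
    obtain ⟨ρ, rfl⟩ := hv
    refine ⟨fun x => (θ x).subst δ,
      (c.subst fun x => .var (ρ x)).subst fun x => (θ x).subst δ, ?_, ?_, ?_, ?_⟩
    · rw [Clause.subst_subst]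
      exact subst_mem_ground hc _
    · rw [← Atom.subst_subst, hθ, Atom.subst_subst]
      rfl
    · rw [substQuery_substQuery]
      simp [substQuery, Clause.subst]
    · simp [substQuery, Clause.subst]
  intro i hi
  rcases lt_or_ge i c'.body.length with hlt | hge
  -- Position inside the clause body: the level is at most that of the head, an instance of `A`, and
  -- position 0 of the old query carries no truth condition.
  · obtain ⟨N, hN⟩ := (hQ 0 (by simp)).bddAbove
    refine (Set.finite_Iic N).subset ?_
    rintro _ ⟨G, hG, hpre, B, hB, rfl⟩
    obtain ⟨δ, rfl⟩ := isGroundInstQuery_iff.1 hG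
    obtain ⟨ε, g, hg, hhead, hbody, hlen⟩ := key δ
    rw [hbody] at hpre hB
    rw [List.getElem?_append_left (by omega)] at hB
    rw [List.take_append_of_le_length (by omega)] at hpre
    obtain ⟨hi', rfl⟩ := List.getElem?_eq_some_iff.1 hB
    have h1 : lev g.body[i] ≤ lev g.head :=
      hlev g hg (g.body.take i) _ (g.body.drop (i + 1)) (by simp) hpre
    have h2 : lev g.head ∈ levelSet lev M (A :: Bs) 0 :=
      ⟨substQuery (A :: Bs) ε, isGroundInstQuery_iff.2 ⟨ε, rfl⟩, by simp, g.head,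
        by simp [substQuery, hhead], rfl⟩
    exact h1.trans (hN h2)
  -- Position `j` of `Bs` was position `j + 1` of the old query. The preceding body of `g` is true,
  -- so the model makes the instance of `A` true as well, and the old level set applies.
  · obtain ⟨j, rfl⟩ := Nat.exists_eq_add_of_le hge
    have hj : j + 1 < (A :: Bs).length := by
      simp [substQuery] at hi
      simpa using hi
    refine (hQ (j + 1) hj).subset ?_
    rintro _ ⟨G, hG, hpre, B, hB, rfl⟩
    obtain ⟨δ, rfl⟩ := isGroundInstQuery_iff.1 hG
    obtain ⟨ε, g, hg, hhead, hbody, hlen⟩ := key δ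
    rw [hbody, ← hlen] at hpre hB
    rw [List.getElem?_append_right (by omega), Nat.add_sub_cancel_left] at hB
    rw [List.take_length_add_append] at hpre
    refine ⟨substQuery (A :: Bs) ε, isGroundInstQuery_iff.2 ⟨ε, rfl⟩, ?_, B, ?_, rfl⟩
    · have hmem : g.head ∈ M := hM g hg fun B hB => hpre B (List.mem_append_left _ hB)
      intro C hC
      simp only [substQuery, List.map_cons, List.take_succ_cons, List.mem_cons] at hC
      rcases hC with rfl | hC
      · rwa [hhead]
      · exact hpre C (List.mem_append_right _ hC)
    · simpa [substQuery] using hB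

theorem BoundedQuery.of_isDescendant [Nonempty (L.Term Empty)] {P : Program L}
    {lev : LevelMapping L} {M : Set (GroundAtom L)} (hM : IsModel M P)
    (hlev : WeaklyDecreasing P lev M) {Q Q' : Query L ℕ} (hQ : BoundedQuery lev M Q)
    (h : IsDescendant P Q Q') : BoundedQuery lev M Q' := by
  obtain ⟨V, h⟩ := h
  induction h with
  | start => exact hQ
  | step _ hc hv _ hθ ih => exact ih.resolvent hM hlev hc hv hθ.2.1

theorem BoundedQuery.boundedAtom_head [Nonempty (L.Term Empty)] {lev : LevelMapping L}
    {M : Set (GroundAtom L)} {A : Atom L ℕ} {Bs : Query L ℕ}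
    (h : BoundedQuery lev M (A :: Bs)) : BoundedAtom lev A := by
  refine (h 0 (by simp)).subset ?_
  rintro _ ⟨G, hG, rfl⟩
  obtain ⟨δ, rfl⟩ := isGroundInstAtom_iff.1 hG
  exact ⟨substQuery (A :: Bs) δ, isGroundInstQuery_iff.2 ⟨δ, rfl⟩, by simp, A.subst δ,
    by simp [substQuery], rfl⟩

theorem BoundedQuery.boundedAtom_of_mem_call {P : Program L} {lev : LevelMapping L}
    {M : Set (GroundAtom L)} (hM : IsModel M P) (hlev : WeaklyDecreasing P lev M)
    {Q : Query L ℕ} (hQ : BoundedQuery lev M Q) {A : Atom L ℕ} (hA : A ∈ Call P Q) :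
    BoundedAtom lev A := by
  -- Without closed terms `A` may have a ground instance while the rest of the query has none, so
  -- boundedness of the query would say nothing about `A`.
  rcases isEmpty_or_nonempty (L.Term Empty)
  · exact boundedAtom_of_isEmpty lev A
  · obtain ⟨Bs, hBs⟩ := hA
    exact (hQ.of_isDescendant hM hlev hBs).boundedAtom_head

/-! ### Comparison of level mappings -/

theorem BoundedAtom.mono {lev lev' : LevelMapping L} {A : Atom L ℕ} (h : BoundedAtom lev A)
    (hle : ∀ G : GroundAtom L, G.rel = A.rel → lev' G ≤ lev G) : BoundedAtom lev' A := by
  obtain ⟨N, hN⟩ := Set.Finite.bddAbove h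
  refine (Set.finite_Iic N).subset ?_
  rintro _ ⟨G, hG, rfl⟩
  exact (hle G hG.rel_eq).trans (hN ⟨G, hG, rfl⟩)

theorem BoundedQuery.mono {lev lev' : LevelMapping L} {M : Set (GroundAtom L)} {Q : Query L ℕ}
    (h : BoundedQuery lev M Q) (hle : ∀ G, lev' G ≤ lev G) : BoundedQuery lev' M Q := by
  intro i hi
  obtain ⟨N, hN⟩ := (h i hi).bddAbove
  refine (Set.finite_Iic N).subset ?_
  rintro _ ⟨G, hG, hpre, B, hB, rfl⟩
  exact (hle B).trans (hN ⟨G, hG, hpre, B, hB, rfl⟩)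

theorem BoundedAtom.moduleLevel {lev : LevelMapping L} {A : Atom L ℕ} (h : BoundedAtom lev A)
    (P : Program L) : BoundedAtom (moduleLevel P lev) A := by
  obtain ⟨N, hN⟩ := Set.Finite.bddAbove h
  refine (Set.finite_Iic (N + 1)).subset ?_
  rintro _ ⟨G, hG, rfl⟩
  have := hN ⟨G, hG, rfl⟩
  simp only [LP.moduleLevel, Set.mem_Iic]
  split_ifs <;> omega

theorem StronglyBounded.moduleLevel {n : ℕ} {R : Fin n → Program L} {lev : Fin n → LevelMapping L}
    {Q : Query L ℕ} (h : StronglyBounded R lev Q) :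
    StronglyBounded R (fun i => moduleLevel (R i) (lev i)) Q :=
  fun A hA i hi => (h A hA i hi).moduleLevel (R i)

/-! ### Dependencies in ground clauses and in extensions -/

theorem definedIn_head {P : Program L} {g : Clause L Empty} (hg : g ∈ ground P) :
    DefinedIn g.head.rel P := by
  obtain ⟨c, hc, σ, h⟩ := hg
  exact ⟨c, hc, congrArg (fun c => c.head.rel) h⟩

theorem refersTo_of_mem_body {P : Program L} {g : Clause L Empty} (hg : g ∈ ground P)
    {B : GroundAtom L} (hB : B ∈ g.body) : RefersTo P g.head.rel B.rel := by
  obtain ⟨c, hc, σ, h⟩ := hg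
  refine ⟨c, hc, congrArg (fun c => c.head.rel) h, ?_⟩
  have hmem : B.subst (incl L) ∈ (c.subst σ).body := by
    rw [h]
    exact List.mem_map_of_mem hB
  obtain ⟨C, hC, hCB⟩ := List.mem_map.1 hmem
  exact ⟨C, hC, congrArg Atom.rel hCB⟩

theorem RefersTo.occursIn {P : Program L} {p q : Pred L} (h : RefersTo P p q) :
    OccursIn q P := by
  obtain ⟨c, hc, -, hB⟩ := h
  exact ⟨c, hc, .inr hB⟩

theorem DefinedIn.occursIn {P : Program L} {p : Pred L} (h : DefinedIn p P) : OccursIn p P := by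
  obtain ⟨c, hc, h⟩ := h
  exact ⟨c, hc, .inl h⟩

theorem ground_mono {P P' : Program L} (h : P ⊆ P') : ground P ⊆ ground P' :=
  fun _ ⟨c, hc, hσ⟩ => ⟨c, h hc, hσ⟩

theorem ground_union (P P' : Program L) : ground (P ∪ P') = ground P ∪ ground P' := by
  ext g
  simp [ground, or_and_right, exists_or]

theorem IsModel.mono {M : Set (GroundAtom L)} {P P' : Program L} (hM : IsModel M P')
    (h : P ⊆ P') : IsModel M P :=
  fun c hc => hM c (ground_mono h hc)

theorem DependsOn.mono {P P' : Program L} (h : P ⊆ P') {p q : Pred L} (hpq : DependsOn P p q) :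
    DependsOn P' p q :=
  Relation.ReflTransGen.mono (fun _ _ ⟨c, hc, hpq⟩ => ⟨c, h hc, hpq⟩) _ _ hpq

section Extension

variable {P R : Program L} {p q : Pred L}

theorem Extends.refersTo_of_occursIn (h : Extends P R) (hp : OccursIn p R)
    (hpq : RefersTo (P ∪ R) p q) : RefersTo R p q := by
  obtain ⟨c, hc | hc, hhead, hB⟩ := hpq
  · exact absurd hp (h p ⟨c, hc, hhead⟩)
  · exact ⟨c, hc, hhead, hB⟩

/-- A relation occurring in `R` is never the head of a clause of `P`, so a dependency path that
starts in `R` stays in `R`. -/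
theorem Extends.dependsOn_of_occursIn (h : Extends P R) (hp : OccursIn p R)
    (hpq : DependsOn (P ∪ R) p q) : DependsOn R p q := by
  induction hpq using Relation.ReflTransGen.head_induction_on with
  | refl => exact .refl
  | head hab _ ih =>
    have hab := h.refersTo_of_occursIn hp hab
    exact .head hab (ih hab.occursIn)

theorem Extends.occursIn_of_dependsOn (h : Extends P R) (hp : OccursIn p R)
    (hpq : DependsOn (P ∪ R) p q) : OccursIn q R := by
  induction hpq with
  | refl => exact hp
  | tail _ hbc ih => exact (h.refersTo_of_occursIn ih hbc).occursIn

/-- A path that once uses a clause of `R` remains in `R`, so it cannot end at a relation defined in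
`P`. -/
theorem Extends.dependsOn_of_definedIn (h : Extends P R) (hq : DefinedIn q P)
    (hpq : DependsOn (P ∪ R) p q) : DependsOn P p q := by
  induction hpq using Relation.ReflTransGen.head_induction_on with
  | refl => exact .refl
  | head hab hbq ih =>
    obtain ⟨c, hc | hc, hhead, hB⟩ := hab
    · exact .head ⟨c, hc, hhead, hB⟩ ih
    · exact absurd (h.occursIn_of_dependsOn (RefersTo.occursIn ⟨c, hc, hhead, hB⟩) hbq) (h q hq)

end Extension

/-! ### From semi-acceptability to acceptability -/

/-- In a semi-acceptable program levels do not increase from heads to bodies. -/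
theorem SemiAcceptable.weaklyDecreasing {P : Program L} {lev : LevelMapping L}
    {M : Set (GroundAtom L)} (h : SemiAcceptable P lev M) : WeaklyDecreasing P lev M := by
  intro g hg As B Bs hbody hAs
  have hdep : DependsOn P g.head.rel B.rel :=
    .single (refersTo_of_mem_body hg (by simp [hbody]))
  obtain ⟨h1, h2⟩ := h.2 g hg As B Bs hbody hAs
  by_cases hBA : DependsOn P B.rel g.head.rel
  · exact (h1 ⟨hdep, hBA⟩).le
  · exact h2 ⟨hdep, hBA⟩

/-- The body atoms of a ground clause lie in its Herbrand base, so that truth in `M` and in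
`M ∩ herbrandBase P` agree on them. -/
theorem forall_mem_inter_herbrandBase {P : Program L} {M : Set (GroundAtom L)}
    {g : Clause L Empty} (hg : g ∈ ground P) {As Bs : Query L Empty} (hbody : g.body = As ++ Bs)
    (hAs : ∀ A ∈ As, A ∈ M) : ∀ A ∈ As, A ∈ M ∩ herbrandBase P :=
  fun A hA => ⟨hAs A hA, (refersTo_of_mem_body hg (by simp [hbody, hA])).occursIn⟩

/-- A module whose defined relations that depend on each other are mutually recursive is
acceptable with respect to its shifted level mapping if it is semi-acceptable. -/
theorem Acceptable.moduleLevel {P : Program L} {lev : LevelMapping L} {M : Set (GroundAtom L)}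
    (hM : IsModel M P) (h : SemiAcceptable P lev (M ∩ herbrandBase P) ∨ SemiAcceptable P lev M)
    (hrec : ∀ p q, DefinedIn p P → DefinedIn q P → DependsOn P p q → DependsOn P q p) :
    Acceptable P (moduleLevel P lev) M := by
  refine ⟨hM, fun g hg As B Bs hbody hAs => ?_⟩
  have hA := definedIn_head hg
  by_cases hB : DefinedIn B.rel P
  · have hdep : DependsOn P g.head.rel B.rel :=
      .single (refersTo_of_mem_body hg (by simp [hbody]))
    have hmut : MutRec P g.head.rel B.rel := ⟨hdep, hrec _ _ hA hB hdep⟩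
    have hlt : lev B < lev g.head := by
      rcases h with h | h
      · exact (h.2 g hg As B Bs hbody (forall_mem_inter_herbrandBase hg hbody hAs)).1 hmut
      · exact (h.2 g hg As B Bs hbody hAs).1 hmut
    simpa [LP.moduleLevel, hA, hB] using hlt
  -- The body atom has level 0, while the shift makes the head level positive.
  · simp [LP.moduleLevel, hA, hB]

open Classical in
/-- The level mapping `lev`, set to `0` on the atoms that are not defined in `P`. -/
noncomputable def definedLevel (P : Program L) (lev : LevelMapping L) : LevelMapping L :=
  fun A => if DefinedIn A.rel P then lev A else 0

theorem definedLevel_le (P : Program L) (lev : LevelMapping L) (A : GroundAtom L) :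
    definedLevel P lev A ≤ lev A := by
  unfold definedLevel
  split_ifs <;> simp

theorem definedIn_union {P R : Program L} {p : Pred L} :
    DefinedIn p (P ∪ R) ↔ DefinedIn p P ∨ DefinedIn p R := by
  simp [DefinedIn, or_and_right, exists_or]

theorem iUnion_pair (P R : Program L) : (⋃ i, (![R, P] : Fin 2 → Program L) i) = P ∪ R := by
  ext c
  simp [Fin.exists_fin_two, or_comm]

end LP

theorem mainTheorem7 {L : FirstOrder.Language.{u, v}} (P R : LP.Program L)
    (M : Set (LP.GroundAtom L)) (levP levR linkP lev : LP.LevelMapping L)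
    (hext : LP.Extends P R)
    (hM : LP.IsModel M (P ∪ R))
    (hR : LP.SemiAcceptable R levR (M ∩ LP.herbrandBase R))
    (hP : LP.SemiAcceptable P levP M)
    (hlink : ∀ c ∈ LP.ground P,
      ∀ (As : LP.Query L Empty) (B : LP.GroundAtom L) (Bs : LP.Query L Empty),
        c.body = As ++ B :: Bs → (∀ A ∈ As, A ∈ M) →
          (LP.DefinedIn B.rel P → linkP B ≤ linkP c.head) ∧
          (LP.DefinedIn B.rel R → levR B ≤ linkP c.head))
    (hlevP : ∀ A : LP.GroundAtom L, LP.DefinedIn A.rel P → lev A = levP A + linkP A)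
    (hlevR : ∀ A : LP.GroundAtom L, LP.DefinedIn A.rel R → lev A = levR A)
    (hfinest : LP.IsFinestDecomposition ![R, P] (P ∪ R)) :
    (∀ Q : LP.Query L ℕ, LP.BoundedQuery lev M Q →
      LP.StronglyBounded ![R, P] ![levR, levP] Q) ∧
    (LP.Acceptable R (LP.moduleLevel R levR) M ∧
      LP.Acceptable P (LP.moduleLevel P levP) M ∧
      ∀ Q : LP.Query L ℕ, LP.BoundedQuery lev M Q →
        LP.StronglyBounded ![R, P] ![LP.moduleLevel R levR, LP.moduleLevel P levP] Q)
:= by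
  have hdec : LP.WeaklyDecreasing (P ∪ R) (LP.definedLevel (P ∪ R) lev) M := by
    intro g hg As B Bs hbody hAs
    by_cases hB : LP.DefinedIn B.rel (P ∪ R)
    swap
    · simp [LP.definedLevel, hB]
    have hA := LP.definedIn_head hg
    simp only [LP.definedLevel, hA, hB, if_true]
    rw [LP.ground_union] at hg
    rcases hg with hg | hg
    · rw [hlevP _ (LP.definedIn_head hg)]
      obtain ⟨h1, h2⟩ := hlink g hg As B Bs hbody hAs
      rcases LP.definedIn_union.1 hB with hB | hB
      · rw [hlevP B hB]
        exact Nat.add_le_add (hP.weaklyDecreasing g hg As B Bs hbody hAs) (h1 hB)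
      · rw [hlevR B hB]
        exact (h2 hB).trans (Nat.le_add_left _ _)
    · have hBR : LP.OccursIn B.rel R :=
        (LP.refersTo_of_mem_body hg (by simp [hbody])).occursIn
      have hB : LP.DefinedIn B.rel R :=
        (LP.definedIn_union.1 hB).resolve_left fun h => hext _ h hBR
      rw [hlevR B hB, hlevR _ (LP.definedIn_head hg)]
      exact hR.weaklyDecreasing g hg As B Bs hbody
        (LP.forall_mem_inter_herbrandBase hg hbody hAs)
  have hsb : ∀ Q : LP.Query L ℕ, LP.BoundedQuery lev M Q →
      LP.StronglyBounded ![R, P] ![levR, levP] Q := by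
    intro Q hQ A hA i hi
    rw [LP.iUnion_pair] at hA
    have hb := (hQ.mono (LP.definedLevel_le (P ∪ R) lev)).boundedAtom_of_mem_call hM hdec hA
    -- All ground instances of `A` share its relation, so only atoms defined in module `i` need to
    -- be compared, and there the module level is at most `lev`.
    refine hb.mono fun G hG => ?_
    rw [← hG] at hi
    fin_cases i
    · have hi : LP.DefinedIn G.rel R := hi
      simp [LP.definedLevel, LP.definedIn_union.2 (.inr hi), hlevR G hi]
    · have hi : LP.DefinedIn G.rel P := hi
      simp [LP.definedLevel, LP.definedIn_union.2 (.inl hi), hlevP G hi]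
  have hPR := hfinest.2.2.2
  refine ⟨hsb, ?_, ?_, fun Q hQ => ?_⟩
  · refine LP.Acceptable.moduleLevel (hM.mono Set.subset_union_right) (.inl hR)
      fun p q hp hq hpq => hext.dependsOn_of_occursIn hq.occursIn ?_
    -- A one-way dependency in `P ∪ R` would be `p ⊐ q` within one module.
    by_contra hqp
    exact (hPR 0 p q hp hq).1 ⟨hpq.mono Set.subset_union_right, hqp⟩
  · refine LP.Acceptable.moduleLevel (hM.mono Set.subset_union_left) (.inr hP)
      fun p q hp hq hpq => hext.dependsOn_of_definedIn hp ?_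
    by_contra hqp
    exact (hPR 1 p q hp hq).1 ⟨hpq.mono Set.subset_union_left, hqp⟩
  · convert (hsb Q hQ).moduleLevel using 1
    funext i
    fin_cases i <;> rfl
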